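/- Let $P$ and $W$ be sets of points in the Euclidean plane (possibly sharing points) such that $P\cup W$ is in general position, that is, no three distinct points of $P\cup W$ lie on a line and no four distinct points of $P\cup W$ lie on a circle. For points $a,b$ let $D_{ab}$ be the closed disk with diameter $ab$. The witness Gabriel graph $GG^-(P,W)$ is the graph with vertex set $P$ in which two distinct points $a,b\in P$ are adjacent if and only if no point of $W$ lies in $D_{ab}\setminus\{a,b\}$. A graph $G$ has a witness Gabriel drawing if there are such $P$ and $W$ (with $P\cup W$ in general position) for which $GG^-(P,W)$ is isomorphic to $G$. Theorem. The complete 4-partite graph $K_{3,3,3,3}$ (four parts with three vertices each) has no witness Gabriel drawing. Corollary. No graph that contains $K_{3,3,3,3}$ as an induced subgraph has a witness Gabriel drawing. In particular, for all integers $p,q,r,s\ge 3$, the complete 4-partite graph $K_{p,q,r,s}$ has no witness Gabriel drawing. -/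

import Mathlib

/-- The Euclidean plane. -/
abbrev Plane : Type := EuclideanSpace ℝ (Fin 2)

/-- A set of points of the plane is in general position if no three (distinct) points of it lie
on a line and no four (distinct) points of it lie on a circle. -/
def InGeneralPosition (S : Set Plane) : Prop :=
  (∀ a ∈ S, ∀ b ∈ S, ∀ c ∈ S, a ≠ b → a ≠ c → b ≠ c → ¬ Collinear ℝ {a, b, c}) ∧
  (∀ a ∈ S, ∀ b ∈ S, ∀ c ∈ S, ∀ d ∈ S,
    a ≠ b → a ≠ c → a ≠ d → b ≠ c → b ≠ d → c ≠ d →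
      ¬ EuclideanGeometry.Cospherical {a, b, c, d})

/-- The closed disk whose diameter is the segment from `a` to `b`. -/
def diametralDisk (a b : Plane) : Set Plane :=
  Metric.closedBall (midpoint ℝ a b) (dist a b / 2)

/-- The witness Gabriel graph of the vertex set `P` and the witness set `W`: two distinct points
`a`, `b` of `P` are adjacent if and only if the closed disk with diameter `ab` contains no
witness other than possibly `a` and `b`. The sets `P` and `W` may share points. -/
def witnessGabrielGraph (P W : Set Plane) : SimpleGraph P where
  Adj a b := a ≠ b ∧ W ∩ (diametralDisk (a : Plane) b \ {(a : Plane), (b : Plane)}) = ∅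
  symm := ⟨by
    rintro a b ⟨hab, h⟩
    refine ⟨hab.symm, ?_⟩
    rw [diametralDisk, midpoint_comm, dist_comm, Set.pair_comm]
    exact h⟩
  loopless := ⟨fun _ h => h.1 rfl⟩

/-- The graph `G` has a witness Gabriel drawing: it is isomorphic to the witness Gabriel graph of
some sets `P` and `W` of points of the plane whose union is in general position. -/
def HasWitnessGabrielDrawing {V : Type*} (G : SimpleGraph V) : Prop :=
  ∃ P W : Set Plane, InGeneralPosition (P ∪ W) ∧ Nonempty (G ≃g witnessGabrielGraph P W)

/-- The complete 4-partite graph whose parts have `p`, `q`, `r` and `s` vertices. -/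
abbrev completeFourPartite (p q r s : ℕ) :
    SimpleGraph (Σ i : Fin 4, Fin ((![p, q, r, s] : Fin 4 → ℕ) i)) :=
  SimpleGraph.completeMultipartiteGraph fun i : Fin 4 => Fin ((![p, q, r, s] : Fin 4 → ℕ) i)

/-! A point `w` lies in the disk with diameter `ab` exactly when it sees `a` and `b` under a
nonacute angle (`mem_diametralDisk_iff`). In a drawing of K_{3,3,3,3}, each pair within a part
therefore has a witness that sees it under a nonacute angle, but sees either of its points together
with any point of another part (other than the witness itself) under an acute angle. The orientation
of the pair as seen from its witness directs it, so each part becomes a transitive or a cyclic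
triple.

Let `w` witness `a → a'` and `v` witness `b → b'` in different parts. There is a conflict, an arrow
from `w` to `v`, if `w` sees `a` and `v` under a nonacute angle. The pair `b, b'` captures a point
that lies on the same side of the line `bb'` as `v`. The arrow exists iff `b, b'` captures `a'`, iff
`a, a'` captures `b` (`Facing.dt_first_iff`, `Facing.captured_iff`), and `b, b'` never captures both
`a` and `a'`.

These rules forbid the first pair of a transitive triple to capture a point followed by two others,
while every pair captures a point of each cyclic triple of another part; so the triples are all
transitive or all cyclic. If all are transitive, the witnesses of the four first pairs lie in each
other's acute cones and span only acute angles, which four points cannot do. If all are cyclic, the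
arrows from part `i` to part `j` form a shift `k ↦ c + k` mod 3. Adding angles around a Helly point
common to all acute cones excludes closed triangles and quadrilaterals of arrows, and no choice of
shifts achieves that. -/

/-! ### Inner and cross products, and the acute cone of a pair -/

/-- The inner product of `q - p` and `r - p`. -/
def dt (p q r : Plane) : ℝ := (q 0 - p 0) * (r 0 - p 0) + (q 1 - p 1) * (r 1 - p 1)

/-- The cross product of `q - p` and `r - p`. -/
def cr (p q r : Plane) : ℝ := (q 0 - p 0) * (r 1 - p 1) - (q 1 - p 1) * (r 0 - p 0)

theorem dt_comm (p q r : Plane) : dt p q r = dt p r q := by unfold dt; ring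

theorem cr_swap (p q r : Plane) : cr p r q = -cr p q r := by unfold cr; ring

theorem cr_rotate (p q r : Plane) : cr q r p = cr p q r := by unfold cr; ring

theorem cr_self_right (p q : Plane) : cr p q q = 0 := by unfold cr; ring

theorem dt_self_nonneg (w x : Plane) : 0 ≤ dt w x x :=
  add_nonneg (mul_self_nonneg _) (mul_self_nonneg _)

theorem eq_of_dt_self_eq_zero {w x : Plane} (h : dt w x x = 0) : x = w := by
  unfold dt at h
  have h0 : x 0 - w 0 = 0 := by nlinarith [mul_self_nonneg (x 0 - w 0), mul_self_nonneg (x 1 - w 1)]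
  have h1 : x 1 - w 1 = 0 := by nlinarith [mul_self_nonneg (x 0 - w 0), mul_self_nonneg (x 1 - w 1)]
  ext i
  fin_cases i
  · exact sub_eq_zero.mp h0
  · exact sub_eq_zero.mp h1

theorem dt_self_pos {w x : Plane} (h : x ≠ w) : 0 < dt w x x :=
  lt_of_le_of_ne (dt_self_nonneg w x) fun h0 => h (eq_of_dt_self_eq_zero h0.symm)

theorem dt_apex_left (w x : Plane) : dt w w x = 0 := by unfold dt; ring

theorem dt_apex_right (w x : Plane) : dt w x w = 0 := by unfold dt; ring

theorem cr_apex_left (w x : Plane) : cr w w x = 0 := by unfold cr; ring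

theorem cr_apex_right (w x : Plane) : cr w x w = 0 := by unfold cr; ring

/-- Inner products in the frame given by `a - w`. -/
theorem dt_frame (w a x y : Plane) :
    dt w a a * dt w x y = dt w a x * dt w a y + cr w a x * cr w a y := by
  unfold dt cr; ring

/-- Cross products in the frame given by `a - w`. -/
theorem cr_frame (w a x y : Plane) :
    dt w a a * cr w x y = dt w a x * cr w a y - cr w a x * dt w a y := by
  unfold dt cr; ring

theorem dt_cone (w a a' x y : Plane) :
    cr w a a' * cr w a a' * dt w x y =
      dt w a x * dt w a y * dt w a' a' + dt w a' x * dt w a' y * dt w a a -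
        (dt w a x * dt w a' y + dt w a' x * dt w a y) * dt w a a' := by
  unfold dt cr; ring

theorem ne_left_of_cr_pos {w a a' : Plane} (h : 0 < cr w a a') : a ≠ w := by
  rintro rfl; simp [cr_apex_left] at h

theorem ne_right_of_cr_pos {w a a' : Plane} (h : 0 < cr w a a') : a' ≠ w := by
  rintro rfl; simp [cr_apex_right] at h

theorem ne_of_cr_pos {w a a' : Plane} (h : 0 < cr w a a') : a ≠ a' := by
  rintro rfl; simp [cr_self_right] at h

/-- The directions making no obtuse angle with either of two vectors at angle θ ≥ π/2 fill a cone of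
opening π - θ ≤ π/2. The identity `dt_cone` is the algebraic form of this. -/
theorem dt_nonneg_of_cone {w a a' x y : Plane} (h : dt w a a' ≤ 0) (hc : 0 < cr w a a')
    (h1 : 0 ≤ dt w a x) (h2 : 0 ≤ dt w a' x) (h3 : 0 ≤ dt w a y) (h4 : 0 ≤ dt w a' y) :
    0 ≤ dt w x y := by
  have e := dt_cone w a a' x y
  have : 0 ≤ cr w a a' * cr w a a' * dt w x y := by
    rw [e]
    have := dt_self_nonneg w a
    have := dt_self_nonneg w a'
    have : 0 ≤ -dt w a a' := by linarith
    have : 0 ≤ (dt w a x * dt w a' y + dt w a' x * dt w a y) * -dt w a a' := by positivity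
    have : 0 ≤ dt w a x * dt w a y * dt w a' a' + dt w a' x * dt w a' y * dt w a a := by positivity
    linarith
  exact nonneg_of_mul_nonneg_right this (by positivity)

theorem dt_pos_of_cone {w a a' x y : Plane} (h : dt w a a' ≤ 0) (hc : 0 < cr w a a')
    (h1 : 0 < dt w a x) (h2 : 0 < dt w a' x) (h3 : 0 < dt w a y) (h4 : 0 < dt w a' y) :
    0 < dt w x y := by
  have e := dt_cone w a a' x y
  have : 0 < cr w a a' * cr w a a' * dt w x y := by
    rw [e]
    have := dt_self_pos (ne_left_of_cr_pos hc)
    have := dt_self_pos (ne_right_of_cr_pos hc)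
    have : 0 ≤ -dt w a a' := by linarith
    have : 0 ≤ (dt w a x * dt w a' y + dt w a' x * dt w a y) * -dt w a a' := by positivity
    have : 0 < dt w a x * dt w a y * dt w a' a' + dt w a' x * dt w a' y * dt w a a := by positivity
    linarith
  exact pos_of_mul_pos_right this (by positivity)

/-- A point of the acute cone of `w` lies, seen from `w`, between `a` and `a'`. -/
theorem cr_left_pos_of_cone {w a a' x : Plane} (h : dt w a a' ≤ 0) (hc : 0 < cr w a a')
    (h1 : 0 < dt w a x) (h2 : 0 < dt w a' x) : 0 < cr w a x := by
  have e := dt_frame w a a' x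
  have hs := dt_self_pos (ne_left_of_cr_pos hc)
  have h3 : 0 < dt w a a * dt w a' x := by positivity
  have h4 : dt w a a' * dt w a x ≤ 0 := mul_nonpos_of_nonpos_of_nonneg h h1.le
  have h5 : 0 < cr w a a' * cr w a x := by linarith
  exact pos_of_mul_pos_right h5 hc.le

theorem cr_right_pos_of_cone {w a a' x : Plane} (h : dt w a a' ≤ 0) (hc : 0 < cr w a a')
    (h1 : 0 < dt w a x) (h2 : 0 < dt w a' x) : 0 < cr w x a' := by
  have e := dt_frame w a' a x
  have hs := dt_self_pos (ne_right_of_cr_pos hc)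
  rw [dt_comm w a' a, cr_swap w a a', cr_swap w x a'] at e
  have h3 : 0 < dt w a' a' * dt w a x := by positivity
  have h4 : dt w a a' * dt w a' x ≤ 0 := mul_nonpos_of_nonpos_of_nonneg h h2.le
  have h5 : 0 < cr w a a' * cr w x a' := by linarith
  exact pos_of_mul_pos_right h5 hc.le

/-! ### Two facing witnesses: conflict and capture -/

/-- The reflection of the plane in the first coordinate axis. -/
def mirror (p : Plane) : Plane := !₂[p 0, -p 1]

theorem mirror_injective : Function.Injective mirror := by
  intro p q h
  have h0 : (mirror p) 0 = (mirror q) 0 := by rw [h]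
  have h1 : (mirror p) 1 = (mirror q) 1 := by rw [h]
  simp [mirror] at h0 h1
  ext i
  fin_cases i
  · exact h0
  · exact h1

theorem dt_mirror (p q r : Plane) : dt (mirror p) (mirror q) (mirror r) = dt p q r := by
  simp [dt, mirror]; ring

theorem cr_mirror (p q r : Plane) : cr (mirror p) (mirror q) (mirror r) = -cr p q r := by
  simp [cr, mirror]; ring

/-- `w` sees the pair `a`, `a'` under a nonacute angle, with `a'` counterclockwise from `a`; `v`
sees the pair `b`, `b'` likewise; and each of the two acute cones contains the other pair. -/
structure Facing (w a a' v b b' : Plane) : Prop where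
  dt_left : dt w a a' ≤ 0
  cr_left : 0 < cr w a a'
  dt_right : dt v b b' ≤ 0
  cr_right : 0 < cr v b b'
  sees_b : b ≠ w → 0 < dt w a b ∧ 0 < dt w a' b
  sees_b' : b' ≠ w → 0 < dt w a b' ∧ 0 < dt w a' b'
  sees_a : a ≠ v → 0 < dt v b a ∧ 0 < dt v b' a
  sees_a' : a' ≠ v → 0 < dt v b a' ∧ 0 < dt v b' a'

namespace Facing

variable {w a a' v b b' : Plane}

theorem symm (h : Facing w a a' v b b') : Facing v b b' w a a' :=
  ⟨h.dt_right, h.cr_right, h.dt_left, h.cr_left, h.sees_a, h.sees_a', h.sees_b, h.sees_b'⟩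

/-- Reflection reverses orientation and so exchanges first and second points: each result about `a`
yields one about `a'`. -/
theorem mirror (h : Facing w a a' v b b') :
    Facing (mirror w) (mirror a') (mirror a) (mirror v) (mirror b') (mirror b) where
  dt_left := by rw [dt_mirror, dt_comm]; exact h.dt_left
  cr_left := by rw [cr_mirror, cr_swap, neg_neg]; exact h.cr_left
  dt_right := by rw [dt_mirror, dt_comm]; exact h.dt_right
  cr_right := by rw [cr_mirror, cr_swap, neg_neg]; exact h.cr_right
  sees_b hn := by
    rw [dt_mirror, dt_mirror]; exact (h.sees_b' (fun e => hn (by rw [e]))).symm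
  sees_b' hn := by
    rw [dt_mirror, dt_mirror]; exact (h.sees_b (fun e => hn (by rw [e]))).symm
  sees_a hn := by
    rw [dt_mirror, dt_mirror]; exact (h.sees_a' (fun e => hn (by rw [e]))).symm
  sees_a' hn := by
    rw [dt_mirror, dt_mirror]; exact (h.sees_a (fun e => hn (by rw [e]))).symm

theorem nonneg_b (h : Facing w a a' v b b') : 0 ≤ dt w a b ∧ 0 ≤ dt w a' b := by
  by_cases e : b = w
  · subst e; simp [dt_apex_right]
  · exact ⟨(h.sees_b e).1.le, (h.sees_b e).2.le⟩

theorem nonneg_b' (h : Facing w a a' v b b') : 0 ≤ dt w a b' ∧ 0 ≤ dt w a' b' := by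
  by_cases e : b' = w
  · subst e; simp [dt_apex_right]
  · exact ⟨(h.sees_b' e).1.le, (h.sees_b' e).2.le⟩

theorem ne (h : Facing w a a' v b b') : w ≠ v := by
  rintro rfl
  have h1 := h.sees_a (ne_left_of_cr_pos h.cr_left)
  have h2 := h.sees_a' (ne_right_of_cr_pos h.cr_left)
  have := dt_pos_of_cone h.dt_right h.cr_right h1.1 h1.2 h2.1 h2.2
  linarith [h.dt_left]

/-- If `w` saw `v` nonacutely with both `a` and `a'`, the closed cone of `w` would contain `b`, `b'`
and the reflection of `v`. Then `b` and `b'` would point away from `v`, and `v` would see them under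
an acute angle. -/
theorem dt_second_pos (h : Facing w a a' v b b') (hv : dt w a v ≤ 0) : 0 < dt w a' v := by
  by_contra hv'
  push Not at hv'
  -- `x` is the reflection of `v` in `w`; it lies in the closed cone at `w`
  have hb := dt_nonneg_of_cone h.dt_left h.cr_left h.nonneg_b.1 h.nonneg_b.2 h.nonneg_b'.1
    h.nonneg_b'.2
  let x : Plane := !₂[2 * w 0 - v 0, 2 * w 1 - v 1]
  have hx : ∀ y, dt w y x = -dt w y v := by intro y; simp [dt, x]; ring
  have h1 := dt_nonneg_of_cone (y := x) h.dt_left h.cr_left h.nonneg_b.1 h.nonneg_b.2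
    (by rw [hx]; linarith) (by rw [hx]; linarith)
  have h2 := dt_nonneg_of_cone (y := x) h.dt_left h.cr_left h.nonneg_b'.1 h.nonneg_b'.2
    (by rw [hx]; linarith) (by rw [hx]; linarith)
  rw [hx] at h1 h2
  have e : dt v b b' = dt w b b' - dt w b v - dt w b' v + dt w v v := by unfold dt; ring
  have := dt_self_pos h.ne.symm
  linarith [h.dt_right]

/-- Otherwise, seen from `v`, counterclockwise turns lead from `a` to `w` and on to `b`, whereas the
acute cone of `v` puts `a` counterclockwise from `b`. -/
theorem cr_first_pos (h : Facing w a a' v b b') (hv : dt w a v ≤ 0) : 0 < cr w a v := by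
  by_contra hc
  push Not at hc
  have hv' := h.dt_second_pos hv
  have hs := dt_self_pos (ne_left_of_cr_pos h.cr_left)
  have hav : a ≠ v := by
    rintro rfl; linarith
  have hvv := dt_self_pos h.ne.symm
  -- `b` is weakly counterclockwise from `w`, seen from `v`
  have key : 0 ≤ cr v w b := by
    have e1 := dt_frame w a a' v
    have e2 := dt_frame w a a' b
    have e3 := cr_frame w a v b
    have hb := h.nonneg_b
    have hl := h.dt_left
    have hcl := h.cr_left
    have p1 : 0 < dt w a a' * dt w a v + cr w a a' * cr w a v := by rw [← e1]; positivity
    have p2 : 0 ≤ dt w a a' * dt w a b + cr w a a' * cr w a b := by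
      rw [← e2]; exact mul_nonneg hs.le hb.2
    have p3 : dt w a v * (dt w a a' * dt w a b + cr w a a' * cr w a b) ≤ 0 :=
      mul_nonpos_of_nonpos_of_nonneg hv p2
    have p4 : 0 ≤ dt w a b * (dt w a a' * dt w a v + cr w a a' * cr w a v) :=
      mul_nonneg hb.1 p1.le
    have p5 : (cr w a a' * dt w a a) * cr w v b ≤ 0 := by
      have : (cr w a a' * dt w a a) * cr w v b =
          dt w a v * (dt w a a' * dt w a b + cr w a a' * cr w a b) -
          dt w a b * (dt w a a' * dt w a v + cr w a a' * cr w a v) := by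
        rw [mul_assoc, e3]; ring
      linarith
    have p6 : cr w v b ≤ 0 := by
      by_contra hh
      push Not at hh
      have : 0 < (cr w a a' * dt w a a) * cr w v b := by positivity
      linarith
    have : cr v w b = -cr w v b := by unfold cr; ring
    linarith
  have ha := h.sees_a hav
  have c1 := cr_left_pos_of_cone h.dt_right h.cr_right ha.1 ha.2
  have d1 : 0 < dt v a w := by
    have : dt v a w = dt w v v - dt w a v := by unfold dt; ring
    linarith
  have c2 : 0 ≤ cr v a w := by
    have : cr v a w = -cr w a v := by unfold cr; ring
    linarith
  have e := cr_frame v a w b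
  have hsa := dt_self_pos hav
  rw [dt_comm v a b, cr_swap v b a] at e
  have q1 : 0 < dt v a w * cr v b a := by positivity
  have q2 : 0 ≤ cr v a w * dt v b a := mul_nonneg c2 ha.1.le
  have q3 : 0 ≤ dt v a a * cr v w b := by positivity
  linarith

/-- An arrow that leaves `w` at its first point arrives at `v` at its second point. If not, either
`v` has an outgoing arrow to `w` as well, or `w` lies in the acute cone of `v`; both contradict the
orientations already known. -/
theorem dt_dual (h : Facing w a a' v b b') (hv : dt w a v ≤ 0) : dt v b' w ≤ 0 := by
  by_contra hw'
  push Not at hw'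
  have hc := h.cr_first_pos hv
  have hs := dt_self_pos (ne_left_of_cr_pos h.cr_left)
  have hav : a ≠ v := by
    rintro rfl; linarith
  have hvv := dt_self_pos h.ne.symm
  by_cases hw : dt v b w ≤ 0
  · have f := h.symm.cr_first_pos hw
    have ha := h.sees_a hav
    have c1 := cr_left_pos_of_cone h.dt_right h.cr_right ha.1 ha.2
    have d1 : 0 < dt v a w := by
      have : dt v a w = dt w v v - dt w a v := by unfold dt; ring
      linarith
    have c2 : cr v a w < 0 := by
      have : cr v a w = -cr w a v := by unfold cr; ring
      linarith
    have e := dt_frame v a w b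
    have hsa := dt_self_pos hav
    rw [dt_comm v a b, cr_swap v b a, dt_comm v w b] at e
    have q1 : 0 < dt v a w * dt v b a := mul_pos d1 ha.1
    have q2 : 0 < cr v a w * -cr v b a := mul_pos_of_neg_of_neg c2 (by linarith)
    have q3 : dt v a a * dt v b w ≤ 0 := mul_nonpos_of_nonneg_of_nonpos hsa.le hw
    linarith
  · push Not at hw
    have c := cr_left_pos_of_cone h.dt_right h.cr_right hw hw'
    have e3 := cr_frame w a b v
    have hb := h.nonneg_b
    have e2 := dt_frame w a a' b
    have p2 : 0 ≤ cr w a b := by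
      have h1 : 0 ≤ dt w a a * dt w a' b := mul_nonneg hs.le hb.2
      have h2 : dt w a a' * dt w a b ≤ 0 := mul_nonpos_of_nonpos_of_nonneg h.dt_left hb.1
      have h3 : 0 ≤ cr w a a' * cr w a b := by linarith
      exact nonneg_of_mul_nonneg_right h3 h.cr_left
    have p3 : 0 ≤ dt w a b * cr w a v := mul_nonneg hb.1 hc.le
    have p4 : cr w a b * dt w a v ≤ 0 := mul_nonpos_of_nonneg_of_nonpos p2 hv
    have p5 : 0 ≤ dt w a a * cr w b v := by linarith
    have p6 : 0 ≤ cr w b v := nonneg_of_mul_nonneg_right p5 hs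
    have : cr v b w = -cr w b v := by unfold cr; ring
    linarith

theorem dt_dual_iff (h : Facing w a a' v b b') : dt w a v ≤ 0 ↔ dt v b' w ≤ 0 := by
  refine ⟨h.dt_dual, fun hw => ?_⟩
  have := h.mirror.symm.dt_dual (by rw [dt_mirror]; exact hw)
  rwa [dt_mirror] at this

theorem cr_second_neg (h : Facing w a a' v b b') (hv : dt w a' v ≤ 0) : cr w a' v < 0 := by
  have := h.mirror.cr_first_pos (by rw [dt_mirror]; exact hv)
  rw [cr_mirror] at this
  linarith

/-- An arrow passes beyond the second point too: seen from `v`, clockwise from `b'`, the witness `w`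
is at least a right angle away and `a'` less than one. -/
theorem cr_second_pos (h : Facing w a a' v b b') (hv : dt w a v ≤ 0) (ne : a' ≠ v) :
    0 < cr w a' v := by
  by_contra hc
  push Not at hc
  have hd := h.dt_dual hv
  have hf := h.symm.cr_second_neg hd
  have ha := h.sees_a' ne
  have c1 := cr_right_pos_of_cone h.dt_right h.cr_right ha.1 ha.2
  have hs := dt_self_pos (ne_right_of_cr_pos h.cr_right)
  have e := cr_frame v b' w a'
  have c2 : cr v b' a' = -cr v a' b' := cr_swap _ _ _
  have c3 : cr v w a' = cr w a' v := by unfold cr; ring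
  rw [c2, c3] at e
  have q1 : 0 ≤ dt v b' w * -cr v a' b' := mul_nonneg_of_nonpos_of_nonpos hd (by linarith)
  have q2 : cr v b' w * dt v b' a' < 0 := mul_neg_of_neg_of_pos hf ha.2
  have q3 : dt v b' b' * cr w a' v ≤ 0 := mul_nonpos_of_nonneg_of_nonpos hs.le hc
  linarith

theorem cr_first_neg (h : Facing w a a' v b b') (hv : dt w a' v ≤ 0) (ne : a ≠ v) :
    cr w a v < 0 := by
  have := h.mirror.cr_second_pos (by rw [dt_mirror]; exact hv)
    (fun e => ne (mirror_injective e))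
  rw [cr_mirror] at this
  linarith

theorem cr_nonpos_b (h : Facing w a a' v b b') :
    cr w a' b ≤ 0 ∧ (b ≠ w → cr w a' b < 0) := by
  by_cases e : b = w
  · subst e; simp [cr_apex_right]
  · have hb := h.sees_b e
    have := cr_right_pos_of_cone h.dt_left h.cr_left hb.1 hb.2
    rw [cr_swap w b a']
    exact ⟨by linarith, fun _ => by linarith⟩

theorem cr_nonpos_b' (h : Facing w a a' v b b') :
    cr w a' b' ≤ 0 ∧ (b' ≠ w → cr w a' b' < 0) := by
  by_cases e : b' = w
  · subst e; simp [cr_apex_right]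
  · have hb := h.sees_b' e
    have := cr_right_pos_of_cone h.dt_left h.cr_left hb.1 hb.2
    rw [cr_swap w b' a']
    exact ⟨by linarith, fun _ => by linarith⟩

/-- The barycentric relation behind the two directions of `dt_first_iff`. -/
theorem barycentric (w a' v b b' : Plane) :
    cr b b' a' * cr w a' v + cr v a' b' * cr w a' b + cr v b a' * cr w a' b' = 0 := by
  unfold cr; ring

/-- Seen from `w`, neither `b` nor `b'` is counterclockwise from `a'`, and `a'` lies inside the
angle `b v b'`. By `barycentric`, `cr b b' a'` and `cr w a' v` then have a positive product, and the
sign of the latter decides whether there is an arrow from `w` to `v`. -/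
theorem dt_first_iff (h : Facing w a a' v b b') : dt w a v ≤ 0 ↔ 0 < cr b b' a' := by
  by_cases ne : a' = v
  · subst ne
    have : cr b b' a' = cr a' b b' := by unfold cr; ring
    rw [this]
    exact ⟨fun _ => h.cr_right, fun _ => h.dt_left⟩
  have ha := h.sees_a' ne
  have c1 := cr_right_pos_of_cone h.dt_right h.cr_right ha.1 ha.2
  have c2 := cr_left_pos_of_cone h.dt_right h.cr_right ha.1 ha.2
  have e := barycentric w a' v b b'
  have hb := h.cr_nonpos_b
  have hb' := h.cr_nonpos_b'
  have hneg : cr v a' b' * cr w a' b + cr v b a' * cr w a' b' < 0 := by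
    by_cases hbw : b = w
    · have : b' ≠ w := fun e' => ne_of_cr_pos h.cr_right (hbw.trans e'.symm)
      have h1 := mul_neg_of_pos_of_neg c2 (hb'.2 this)
      have h2 := mul_nonpos_of_nonneg_of_nonpos c1.le hb.1
      linarith
    · have h1 := mul_neg_of_pos_of_neg c1 (hb.2 hbw)
      have h2 := mul_nonpos_of_nonneg_of_nonpos c2.le hb'.1
      linarith
  have hpos : 0 < cr b b' a' * cr w a' v := by linarith
  constructor
  · intro hv
    exact pos_of_mul_pos_left hpos (h.cr_second_pos hv ne).le
  · intro hc
    have hv : 0 < cr w a' v := pos_of_mul_pos_right hpos hc.le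
    by_contra h1
    push Not at h1
    by_cases h2 : dt w a' v ≤ 0
    · linarith [h.cr_second_neg h2]
    · push Not at h2
      have := cr_right_pos_of_cone h.dt_left h.cr_left h1 h2
      rw [cr_swap] at this
      linarith

theorem dt_second_iff (h : Facing w a a' v b b') : dt w a' v ≤ 0 ↔ 0 < cr b b' a := by
  have := h.mirror.dt_first_iff
  rw [dt_mirror, cr_mirror] at this
  rw [this]
  have : cr b b' a = -cr b' b a := by unfold cr; ring
  rw [this]

/-- Both sides express the arrow from `w` to `v`, read at `w` and at `v`. -/
theorem captured_iff (h : Facing w a a' v b b') : 0 < cr b b' a' ↔ 0 < cr a a' b := by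
  rw [← h.dt_first_iff, h.dt_dual_iff, h.symm.dt_second_iff]

theorem not_captured_both (h : Facing w a a' v b b') (h1 : 0 < cr b b' a)
    (h2 : 0 < cr b b' a') : False := by
  have := h.dt_second_pos (h.dt_first_iff.2 h2)
  linarith [h.dt_second_iff.2 h1]

/-- A witness that is in no conflict and captures nothing sees the pair clockwise. -/
theorem cr_neg_of_not_captured (h : Facing w a a' v b b') (h1 : ¬ 0 < cr b b' a)
    (h2 : ¬ 0 < cr b b' a') : cr v a a' < 0 ∧ 0 < dt v a a' := by
  have p1 : 0 < dt w a v := by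
    by_contra hh; exact h2 (h.dt_first_iff.1 (not_lt.1 hh))
  have p2 : 0 < dt w a' v := by
    by_contra hh; exact h1 (h.dt_second_iff.1 (not_lt.1 hh))
  have e1 : a ≠ v := by
    rintro rfl
    apply h1
    have : cr b b' a = cr a b b' := by unfold cr; ring
    rw [this]; exact h.cr_right
  have e2 : a' ≠ v := by
    rintro rfl
    apply h2
    have : cr b b' a' = cr a' b b' := by unfold cr; ring
    rw [this]; exact h.cr_right
  have q := dt_pos_of_cone h.dt_right h.cr_right (h.sees_a e1).1 (h.sees_a e1).2
    (h.sees_a' e2).1 (h.sees_a' e2).2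
  have c1 := cr_left_pos_of_cone h.dt_left h.cr_left p1 p2
  have c2 := cr_right_pos_of_cone h.dt_left h.cr_left p1 p2
  refine ⟨?_, q⟩
  by_contra hc
  push Not at hc
  -- Here `v` would lie in the triangle `w a a'`, so its angle over `a, a'` would be at least the
  -- nonacute angle at `w`.
  have e : cr v a a' = cr w a a' - cr w v a' - cr w a v := by unfold cr; ring
  have e3 : cr w a a' * dt w v v = cr w v a' * dt w a v + cr w a v * dt w a' v := by
    unfold cr dt; ring
  have e4 : dt v a a' = dt w a a' - dt w a v - dt w a' v + dt w v v := by unfold dt; ring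
  have hcl := h.cr_left
  have s1 : cr w v a' * dt w a v ≤ cr w a a' * dt w a v :=
    mul_le_mul_of_nonneg_right (by linarith) p1.le
  have s2 : cr w a v * dt w a' v ≤ cr w a a' * dt w a' v :=
    mul_le_mul_of_nonneg_right (by linarith) p2.le
  have s3 : cr w a a' * dt w v v ≤ cr w a a' * (dt w a v + dt w a' v) := by linarith
  have s4 := le_of_mul_le_mul_left s3 hcl
  linarith [h.dt_left]

end Facing

/-! ### Configurations with only acute angles -/

/-- A point cannot see the three sides of a triangle clockwise and under acute angles. -/
theorem not_cr_neg_cyclic {v x y z : Plane} (h1 : cr v x y < 0) (h2 : cr v y z < 0)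
    (h3 : cr v z x < 0) (d1 : 0 < dt v x y) (d2 : 0 < dt v x z) : False := by
  have e : dt v x x * cr v y z + dt v x y * cr v z x + dt v x z * cr v x y = 0 := by
    unfold dt cr; ring
  have hs := dt_self_nonneg v x
  have := mul_nonpos_of_nonneg_of_nonpos hs h2.le
  have := mul_neg_of_pos_of_neg d1 h3
  have := mul_neg_of_pos_of_neg d2 h1
  linarith

/-- Either `q` lies inside the triangle `o p r` and sees one of its sides nonacutely, or `o p q r`
is a quadrilateral whose four angles sum to 2π and cannot all be acute. -/
theorem exists_obtuse_of_ordered {o p q r : Plane} (c1 : 0 ≤ cr o p q) (c2 : 0 ≤ cr o q r)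
    (hpr : 0 < dt o p r) (hpq : 0 < dt o p q) (hqr : 0 < dt o q r)
    (p1 : 0 < dt p o q) (r1 : 0 < dt r o q) (q1 : 0 < dt q p r) (q2 : 0 < dt q o p)
    (q3 : 0 < dt q o r) : False := by
  have hq : 0 < dt o q q := by
    apply dt_self_pos; rintro rfl; simp [dt_apex_right] at hpq
  have hne : ∀ x, 0 < dt q p x → 0 < dt q p p := fun x h => by
    apply dt_self_pos; rintro rfl; simp [dt_apex_left] at h
  have hqp := hne r q1
  have hqr' : 0 < dt q r r := by
    apply dt_self_pos; rintro rfl; simp [dt_apex_right] at q1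
  -- the crosses of the four sides
  have cpr : 0 ≤ cr o p r := by
    have e := cr_frame o q p r
    rw [dt_comm o q p, cr_swap o p q] at e
    have : 0 ≤ dt o q q * cr o p r := by
      rw [e]
      have := mul_nonneg hpq.le c2
      have := mul_nonneg c1 hqr.le
      linarith
    exact nonneg_of_mul_nonneg_right this hq
  -- The projections of `p` and `r` to the line `oq` do not pass `q`, which puts `q` beyond the line
  -- `pr`.
  have cq : 0 ≤ cr q r p := by
    have e1 : cr q r p = cr o p q + cr o q r - cr o p r := by unfold cr; ring
    have e2 : dt o q q * cr o p r = dt o p q * cr o q r + dt o q r * cr o p q := by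
      unfold dt cr; ring
    have a1 : dt o p q ≤ dt o q q := by
      have : dt q o p = dt o q q - dt o p q := by unfold dt; ring
      linarith
    have a2 : dt o q r ≤ dt o q q := by
      have : dt q o r = dt o q q - dt o q r := by unfold dt; ring
      linarith
    have s1 := mul_le_mul_of_nonneg_right a1 c2
    have s2 := mul_le_mul_of_nonneg_right a2 c1
    have : dt o q q * cr o p r ≤ dt o q q * (cr o p q + cr o q r) := by linarith
    have := le_of_mul_le_mul_left this hq
    linarith
  -- `e = p - q`, `f = r - q`
  let e0 := p 0 - q 0
  let e1 := p 1 - q 1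
  let f0 := r 0 - q 0
  let f1 := r 1 - q 1
  let P0 := p 0 - o 0
  let P1 := p 1 - o 1
  let R0 := r 0 - o 0
  let R1 := r 1 - o 1
  have de : 0 < e0 * P0 + e1 * P1 := by
    have : dt p o q = e0 * P0 + e1 * P1 := by simp only [dt, e0, e1, P0, P1]; ring
    linarith
  have ce : 0 ≤ e0 * P1 - e1 * P0 := by
    have : cr o p q = e0 * P1 - e1 * P0 := by simp only [cr, e0, e1, P0, P1]; ring
    linarith
  have df : 0 < f0 * R0 + f1 * R1 := by
    have : dt r o q = f0 * R0 + f1 * R1 := by simp only [dt, f0, f1, R0, R1]; ring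
    linarith
  have cf : f0 * R1 - f1 * R0 ≤ 0 := by
    have : cr o q r = -(f0 * R1 - f1 * R0) := by simp only [cr, f0, f1, R0, R1]; ring
    linarith
  have def' : 0 < e0 * f0 + e1 * f1 := q1
  have cef : e0 * f1 - e1 * f0 ≤ 0 := by
    have : cr q r p = -(e0 * f1 - e1 * f0) := by simp only [cr, e0, e1, f0, f1]; ring
    linarith
  have dpr : 0 < P0 * R0 + P1 * R1 := hpr
  have cpr' : R0 * P1 - R1 * P0 ≤ 0 := by
    have : cr o p r = -(R0 * P1 - R1 * P0) := by simp only [cr, P0, P1, R0, R1]; ring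
    linarith
  have ee : 0 < e0 * e0 + e1 * e1 := hqp
  have ff : 0 < f0 * f0 + f1 * f1 := hqr'
  -- The turn from `r - q` to `p - o` is counterclockwise when made via `p - q` and clockwise via `r
  -- - o` (`m3`). So it vanishes, and `o, p, q` are collinear.
  have m1 : 0 ≤ f0 * P1 - f1 * P0 := by
    have : (e0 * e0 + e1 * e1) * (f0 * P1 - f1 * P0) =
      (e0 * f0 + e1 * f1) * (e0 * P1 - e1 * P0) + -(e0 * f1 - e1 * f0) * (e0 * P0 + e1 * P1) := by
      ring
    have h1 := mul_nonneg def'.le ce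
    have h2 : 0 ≤ -(e0 * f1 - e1 * f0) * (e0 * P0 + e1 * P1) := mul_nonneg (by linarith) de.le
    exact nonneg_of_mul_nonneg_right (by linarith) ee
  have m2 : 0 < f0 * P0 + f1 * P1 := by
    have : (f0 * f0 + f1 * f1) * (P0 * R0 + P1 * R1) = (f0 * P0 + f1 * P1) * (f0 * R0 + f1 * R1)
      + (f0 * P1 - f1 * P0) * (f0 * R1 - f1 * R0) := by ring
    have h1 : 0 < (f0 * f0 + f1 * f1) * (P0 * R0 + P1 * R1) := by positivity
    have h2 := mul_nonpos_of_nonneg_of_nonpos m1 cf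
    have h3 : 0 < (f0 * P0 + f1 * P1) * (f0 * R0 + f1 * R1) := by linarith
    exact pos_of_mul_pos_left h3 df.le
  have m3 : f0 * P1 - f1 * P0 ≤ 0 := by
    have : (f0 * f0 + f1 * f1) * (R0 * P1 - R1 * P0) = (f0 * R0 + f1 * R1) * (f0 * P1 - f1 * P0)
      - (f0 * R1 - f1 * R0) * (f0 * P0 + f1 * P1) := by ring
    have h1 : (f0 * f0 + f1 * f1) * (R0 * P1 - R1 * P0) ≤ 0 :=
      mul_nonpos_of_nonneg_of_nonpos ff.le cpr'
    have h2 := mul_nonpos_of_nonpos_of_nonneg cf m2.le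
    by_contra hh
    push Not at hh
    have := mul_pos df hh
    linarith
  have m4 : e0 * P1 - e1 * P0 ≤ 0 := by
    have : (e0 * e0 + e1 * e1) * (f0 * P1 - f1 * P0) =
      (e0 * f0 + e1 * f1) * (e0 * P1 - e1 * P0) + -(e0 * f1 - e1 * f0) * (e0 * P0 + e1 * P1) := by
      ring
    have h1 : (e0 * e0 + e1 * e1) * (f0 * P1 - f1 * P0) ≤ 0 :=
      mul_nonpos_of_nonneg_of_nonpos ee.le m3
    have h2 : 0 ≤ -(e0 * f1 - e1 * f0) * (e0 * P0 + e1 * P1) := mul_nonneg (by linarith) de.le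
    by_contra hh
    push Not at hh
    have := mul_pos def' hh
    linarith
  have c0 : cr o p q = 0 := by
    have : cr o p q = e0 * P1 - e1 * P0 := by simp only [cr, e0, e1, P0, P1]; ring
    linarith
  have e := dt_frame o p q q
  rw [c0] at e
  have b1 : dt o p q < dt o q q := by
    have : dt q o p = dt o q q - dt o p q := by unfold dt; ring
    linarith
  have b2 : dt o p q < dt o p p := by
    have : dt p o q = dt o p p - dt o p q := by unfold dt; ring
    linarith
  have := mul_lt_mul'' b2 b1 hpq.le hpq.le
  linarith

/-- Among any four points of the plane, three span a nonacute angle. -/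
theorem four_points_not_all_acute (p : Fin 4 → Plane)
    (h : ∀ i j k, i ≠ j → i ≠ k → j ≠ k → 0 < dt (p i) (p j) (p k)) : False := by
  have key : ∀ x y z : Fin 4, x ≠ 0 → y ≠ 0 → z ≠ 0 → x ≠ y → x ≠ z → y ≠ z →
      0 ≤ cr (p 0) (p x) (p y) → 0 ≤ cr (p 0) (p y) (p z) → False := by
    intro x y z hx hy hz hxy hxz hyz c1 c2
    exact exists_obtuse_of_ordered c1 c2 (h 0 x z hx.symm hz.symm hxz) (h 0 x y hx.symm hy.symm hxy)
      (h 0 y z hy.symm hz.symm hyz) (h x 0 y hx hxy hy.symm) (h z 0 y hz hyz.symm hy.symm)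
      (h y x z hxy.symm hyz hxz) (h y 0 x hy hxy.symm hx.symm) (h y 0 z hy hyz hz.symm)
  have sw : ∀ x y : Fin 4, cr (p 0) (p x) (p y) = -cr (p 0) (p y) (p x) := fun x y => cr_swap _ _ _
  rcases le_total 0 (cr (p 0) (p 1) (p 2)) with h12 | h12 <;>
  rcases le_total 0 (cr (p 0) (p 2) (p 3)) with h23 | h23 <;>
  rcases le_total 0 (cr (p 0) (p 1) (p 3)) with h13 | h13
  · exact key 1 2 3 (by decide) (by decide) (by decide) (by decide) (by decide) (by decide) h12 h23
  · exact key 1 2 3 (by decide) (by decide) (by decide) (by decide) (by decide) (by decide) h12 h23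
  · exact key 1 3 2 (by decide) (by decide) (by decide) (by decide) (by decide) (by decide) h13
      (by rw [sw]; linarith)
  · exact key 3 1 2 (by decide) (by decide) (by decide) (by decide) (by decide) (by decide)
      (by rw [sw]; linarith) h12
  · exact key 2 1 3 (by decide) (by decide) (by decide) (by decide) (by decide) (by decide)
      (by rw [sw]; linarith) h13
  · exact key 2 3 1 (by decide) (by decide) (by decide) (by decide) (by decide) (by decide)
      h23 (by rw [sw]; linarith)
  · exact key 3 2 1 (by decide) (by decide) (by decide) (by decide) (by decide) (by decide)
      (by rw [sw]; linarith) (by rw [sw]; linarith)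
  · exact key 3 2 1 (by decide) (by decide) (by decide) (by decide) (by decide) (by decide)
      (by rw [sw]; linarith) (by rw [sw]; linarith)

/-! ### From inner and cross products to angle measures -/

theorem inner_sub_sub_eq_dt (v x y : Plane) : inner ℝ (x - v) (y - v) = dt v x y := by
  simp [PiLp.inner_apply, Fin.sum_univ_two, dt]; ring

open EuclideanGeometry in
theorem norm_mul_norm_mul_cos_angle (v x y : Plane) :
    ‖x - v‖ * ‖y - v‖ * Real.cos (∠ x v y) = dt v x y := by
  unfold EuclideanGeometry.angle
  rw [mul_comm, vsub_eq_sub, vsub_eq_sub, InnerProductGeometry.cos_angle_mul_norm_mul_norm,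
    inner_sub_sub_eq_dt]

open EuclideanGeometry in
theorem norm_mul_norm_mul_sin_angle {v x y : Plane} (h : 0 ≤ cr v x y) :
    ‖x - v‖ * ‖y - v‖ * Real.sin (∠ x v y) = cr v x y := by
  unfold EuclideanGeometry.angle
  rw [mul_comm, vsub_eq_sub, vsub_eq_sub, InnerProductGeometry.sin_angle_mul_norm_mul_norm,
    inner_sub_sub_eq_dt, inner_sub_sub_eq_dt, inner_sub_sub_eq_dt, ← Real.sqrt_sq h]
  congr 1
  unfold dt cr; ring

theorem norm_sub_pos_of_ne {x v : Plane} (h : x ≠ v) : 0 < ‖x - v‖ :=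
  norm_pos_iff.2 (sub_ne_zero.2 h)

theorem norm_sub_mul_norm_sub (x v : Plane) : ‖x - v‖ * ‖x - v‖ = dt v x x := by
  rw [← real_inner_self_eq_norm_mul_norm, inner_sub_sub_eq_dt]

open EuclideanGeometry in
/-- If two consecutive angles at `v` add up to an acute angle, so does the angle they form. -/
theorem angle_add_angle_cases {v w o u : Plane} (h1 : 0 < cr v w o) (h2 : 0 < cr v o u) :
    (∠ w v o + ∠ o v u < Real.pi / 2 → 0 < cr v w u ∧ 0 < dt v w u) ∧
    (∠ w v o + ∠ o v u ≤ Real.pi / 2 → 0 < cr v w u ∧ 0 ≤ dt v w u) := by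
  have n1 := norm_sub_pos_of_ne (ne_left_of_cr_pos h1)
  have n2 := norm_sub_pos_of_ne (ne_right_of_cr_pos h1)
  have n3 := norm_sub_pos_of_ne (ne_right_of_cr_pos h2)
  have c1 := norm_mul_norm_mul_cos_angle v w o
  have c2 := norm_mul_norm_mul_cos_angle v o u
  have s1 := norm_mul_norm_mul_sin_angle h1.le
  have s2 := norm_mul_norm_mul_sin_angle h2.le
  have a1 : 0 < Real.sin (∠ w v o) := by
    rw [← s1] at h1; exact pos_of_mul_pos_right h1 (by positivity)
  have a0 : 0 < ∠ w v o := by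
    refine lt_of_le_of_ne (EuclideanGeometry.angle_nonneg _ _ _) fun e => ?_
    rw [← e] at a1; simp at a1
  have b0 : 0 ≤ ∠ o v u := EuclideanGeometry.angle_nonneg _ _ _
  set l := ∠ w v o
  set r := ∠ o v u
  have hs := norm_sub_mul_norm_sub o v
  have ec : dt v o o * dt v w u = ‖w - v‖ * ‖o - v‖ * (‖o - v‖ * ‖u - v‖) * Real.cos (l + r) := by
    rw [Real.cos_add]
    have := dt_frame v o w u
    rw [dt_comm v o w, cr_swap v w o] at this
    rw [this, ← c1, ← c2, ← s1, ← s2]; ring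
  have es : dt v o o * cr v w u = ‖w - v‖ * ‖o - v‖ * (‖o - v‖ * ‖u - v‖) * Real.sin (l + r) := by
    rw [Real.sin_add]
    have := cr_frame v o w u
    rw [dt_comm v o w, cr_swap v w o] at this
    rw [this, ← c1, ← c2, ← s1, ← s2]; ring
  have ho : 0 < dt v o o := dt_self_pos (ne_right_of_cr_pos h1)
  have hpi := Real.pi_pos
  constructor
  · intro hlt
    have hc : 0 < Real.cos (l + r) := Real.cos_pos_of_mem_Ioo ⟨by linarith, hlt⟩
    have hsn : 0 < Real.sin (l + r) := Real.sin_pos_of_pos_of_lt_pi (by linarith) (by linarith)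
    exact ⟨pos_of_mul_pos_right (by rw [es]; positivity) ho.le,
      pos_of_mul_pos_right (by rw [ec]; positivity) ho.le⟩
  · intro hle
    have hc : 0 ≤ Real.cos (l + r) := Real.cos_nonneg_of_mem_Icc ⟨by linarith, hle⟩
    have hsn : 0 < Real.sin (l + r) := Real.sin_pos_of_pos_of_lt_pi (by linarith) (by linarith)
    exact ⟨pos_of_mul_pos_right (by rw [es]; positivity) ho.le,
      nonneg_of_mul_nonneg_right (by rw [ec]; positivity) ho⟩

open EuclideanGeometry in
-- Multiplied along a closed counterclockwise tour around `o`, the right-hand sides give a positive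
-- real. The angles of the tour thus add up to a positive multiple of 2π.
theorem exp_angle_mul_norm {o x y : Plane} (h : 0 < cr o x y) :
    Complex.exp (∠ x o y * Complex.I) * (‖x - o‖ * ‖y - o‖ : ℝ) =
      (starRingEnd ℂ) ⟨x 0 - o 0, x 1 - o 1⟩ * ⟨y 0 - o 0, y 1 - o 1⟩ := by
  have c := norm_mul_norm_mul_cos_angle o x y
  have s := norm_mul_norm_mul_sin_angle h.le
  rw [Complex.exp_mul_I, ← Complex.ofReal_cos, ← Complex.ofReal_sin]
  apply Complex.ext
  · simp only [Complex.mul_re, Complex.add_re, Complex.add_im, Complex.ofReal_re,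
      Complex.ofReal_im, Complex.I_re, Complex.I_im, Complex.mul_im, Complex.conj_re,
      Complex.conj_im]
    unfold dt at c
    linarith
  · simp only [Complex.mul_re, Complex.add_re, Complex.add_im, Complex.ofReal_re,
      Complex.ofReal_im, Complex.I_re, Complex.I_im, Complex.mul_im, Complex.conj_re,
      Complex.conj_im]
    unfold cr at s
    linarith

theorem two_pi_le_of_exp_eq_one {S : ℝ} (hS : 0 < S) (h : Complex.exp (S * Complex.I) = 1) :
    2 * Real.pi ≤ S := by
  obtain ⟨n, hn⟩ := Complex.exp_eq_one_iff.1 h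
  have e : (S : ℂ) * Complex.I = ((n * (2 * Real.pi) : ℝ) : ℂ) * Complex.I := by
    rw [hn]; push_cast; ring
  have e2 := mul_right_cancel₀ Complex.I_ne_zero e
  have e3 : S = n * (2 * Real.pi) := by exact_mod_cast e2
  have hp := Real.pi_pos
  have hn1 : 0 < n := by
    by_contra hh
    push Not at hh
    have : (n : ℝ) ≤ 0 := by exact_mod_cast hh
    have := mul_nonpos_of_nonpos_of_nonneg this (by positivity : (0:ℝ) ≤ 2 * Real.pi)
    linarith
  have : (1 : ℝ) ≤ n := by exact_mod_cast hn1
  have := mul_le_mul_of_nonneg_right this (by positivity : (0:ℝ) ≤ 2 * Real.pi)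
  linarith

open EuclideanGeometry in
theorem angle_pos_of_cr_pos {o x y : Plane} (h : 0 < cr o x y) : 0 < ∠ x o y := by
  have s := norm_mul_norm_mul_sin_angle h.le
  refine lt_of_le_of_ne (EuclideanGeometry.angle_nonneg _ _ _) fun e => ?_
  rw [← e] at s; simp at s; linarith

open EuclideanGeometry in
theorem two_pi_le_angle_sum_three {o x y z : Plane} (h1 : 0 < cr o x y) (h2 : 0 < cr o y z)
    (h3 : 0 < cr o z x) : 2 * Real.pi ≤ ∠ x o y + ∠ y o z + ∠ z o x := by
  apply two_pi_le_of_exp_eq_one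
  · linarith [angle_pos_of_cr_pos h1, angle_pos_of_cr_pos h2, angle_pos_of_cr_pos h3]
  have e1 := exp_angle_mul_norm h1
  have e2 := exp_angle_mul_norm h2
  have e3 := exp_angle_mul_norm h3
  have n : ∀ p : Plane, (starRingEnd ℂ) ⟨p 0 - o 0, p 1 - o 1⟩ * ⟨p 0 - o 0, p 1 - o 1⟩ =
      ((‖p - o‖ * ‖p - o‖ : ℝ) : ℂ) := by
    intro p
    rw [norm_sub_mul_norm_sub, ← Complex.normSq_eq_conj_mul_self, Complex.normSq_mk]; rfl
  have nx := norm_sub_pos_of_ne (ne_left_of_cr_pos h1)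
  have ny := norm_sub_pos_of_ne (ne_left_of_cr_pos h2)
  have nz := norm_sub_pos_of_ne (ne_left_of_cr_pos h3)
  have hN : (((‖x - o‖ * ‖x - o‖ : ℝ) : ℂ) * ((‖y - o‖ * ‖y - o‖ : ℝ) : ℂ) *
      ((‖z - o‖ * ‖z - o‖ : ℝ) : ℂ)) ≠ 0 := by
    have : 0 < (‖x - o‖ * ‖x - o‖) * (‖y - o‖ * ‖y - o‖) * (‖z - o‖ * ‖z - o‖) := by positivity
    exact_mod_cast this.ne'
  apply mul_right_cancel₀ hN
  rw [one_mul]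
  have : ((∠ x o y + ∠ y o z + ∠ z o x : ℝ) : ℂ) * Complex.I =
      ∠ x o y * Complex.I + ∠ y o z * Complex.I + ∠ z o x * Complex.I := by push_cast; ring
  rw [this, Complex.exp_add, Complex.exp_add]
  conv_rhs => rw [← n x, ← n y, ← n z]
  calc _ = (Complex.exp (∠ x o y * Complex.I) * (‖x - o‖ * ‖y - o‖ : ℝ)) *
        (Complex.exp (∠ y o z * Complex.I) * (‖y - o‖ * ‖z - o‖ : ℝ)) *
        (Complex.exp (∠ z o x * Complex.I) * (‖z - o‖ * ‖x - o‖ : ℝ)) := by push_cast; ring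
    _ = _ := by rw [e1, e2, e3]; ring

open EuclideanGeometry in
theorem two_pi_le_angle_sum_four {o x y z t : Plane} (h1 : 0 < cr o x y) (h2 : 0 < cr o y z)
    (h3 : 0 < cr o z t) (h4 : 0 < cr o t x) :
    2 * Real.pi ≤ ∠ x o y + ∠ y o z + ∠ z o t + ∠ t o x := by
  apply two_pi_le_of_exp_eq_one
  · linarith [angle_pos_of_cr_pos h1, angle_pos_of_cr_pos h2, angle_pos_of_cr_pos h3,
      angle_pos_of_cr_pos h4]
  have e1 := exp_angle_mul_norm h1
  have e2 := exp_angle_mul_norm h2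
  have e3 := exp_angle_mul_norm h3
  have e4 := exp_angle_mul_norm h4
  have n : ∀ p : Plane, (starRingEnd ℂ) ⟨p 0 - o 0, p 1 - o 1⟩ * ⟨p 0 - o 0, p 1 - o 1⟩ =
      ((‖p - o‖ * ‖p - o‖ : ℝ) : ℂ) := by
    intro p
    rw [norm_sub_mul_norm_sub, ← Complex.normSq_eq_conj_mul_self, Complex.normSq_mk]; rfl
  have nx := norm_sub_pos_of_ne (ne_left_of_cr_pos h1)
  have ny := norm_sub_pos_of_ne (ne_left_of_cr_pos h2)
  have nz := norm_sub_pos_of_ne (ne_left_of_cr_pos h3)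
  have nt := norm_sub_pos_of_ne (ne_left_of_cr_pos h4)
  have hN : (((‖x - o‖ * ‖x - o‖ : ℝ) : ℂ) * ((‖y - o‖ * ‖y - o‖ : ℝ) : ℂ) *
      ((‖z - o‖ * ‖z - o‖ : ℝ) : ℂ) * ((‖t - o‖ * ‖t - o‖ : ℝ) : ℂ)) ≠ 0 := by
    have : 0 < (‖x - o‖ * ‖x - o‖) * (‖y - o‖ * ‖y - o‖) * (‖z - o‖ * ‖z - o‖) *
      (‖t - o‖ * ‖t - o‖) := by positivity
    exact_mod_cast this.ne'
  apply mul_right_cancel₀ hN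
  rw [one_mul]
  have : ((∠ x o y + ∠ y o z + ∠ z o t + ∠ t o x : ℝ) : ℂ) * Complex.I =
      ∠ x o y * Complex.I + ∠ y o z * Complex.I + ∠ z o t * Complex.I + ∠ t o x * Complex.I := by
    push_cast; ring
  rw [this, Complex.exp_add, Complex.exp_add, Complex.exp_add]
  conv_rhs => rw [← n x, ← n y, ← n z, ← n t]
  calc _ = (Complex.exp (∠ x o y * Complex.I) * (‖x - o‖ * ‖y - o‖ : ℝ)) *
        (Complex.exp (∠ y o z * Complex.I) * (‖y - o‖ * ‖z - o‖ : ℝ)) *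
        (Complex.exp (∠ z o t * Complex.I) * (‖z - o‖ * ‖t - o‖ : ℝ)) *
        (Complex.exp (∠ t o x * Complex.I) * (‖t - o‖ * ‖x - o‖ : ℝ)) := by push_cast; ring
    _ = _ := by rw [e1, e2, e3, e4]; ring

/-! ### Paths and cycles of conflicts -/

namespace Facing

variable {w a a' v b b' u c c' o : Plane}

/-- A conflict turns clockwise around every point of the acute cone of `w`. -/
theorem cr_center_pos (h : Facing w a a' v b b') (d : dt w a v ≤ 0) (o1 : 0 < dt w a o)
    (o2 : 0 < dt w a' o) : 0 < cr o v w := by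
  have c1 := h.cr_first_pos d
  have c2 := cr_left_pos_of_cone h.dt_left h.cr_left o1 o2
  have e := cr_frame w a o v
  have hs := dt_self_pos (ne_left_of_cr_pos h.cr_left)
  have h1 := mul_pos o1 c1
  have h2 := mul_nonpos_of_nonneg_of_nonpos c2.le d
  have h3 : 0 < dt w a a * cr w o v := by linarith
  have h4 := pos_of_mul_pos_right h3 hs.le
  have : cr o v w = cr w o v := by unfold cr; ring
  linarith

/-- Seen from `v`, the points `w, b, b', u` follow each other counterclockwise, with `w = b` and `b'
= u` allowed. If `w` to `u` is less than a half turn, it contains the nonacute angle from `b` to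
`b'`. -/
theorem dt_nonpos_of_path (h1 : Facing w a a' v b b') (d1 : dt w a v ≤ 0)
    (h2 : Facing v b b' u c c') (d2 : dt v b u ≤ 0) (hc : 0 < cr v w u) :
    dt v w u ≤ 0 ∧ (dt v w u = 0 → b = w ∧ b' = u) := by
  have e1 := h1.dt_dual d1
  have e2 := h1.symm.cr_second_neg e1
  have e3 := h2.cr_first_pos d2
  have e4 : cr v b w ≤ 0 ∧ (cr v b w = 0 → b = w) := by
    by_cases e : b = w
    · subst e; exact ⟨(cr_self_right _ _).le, fun _ => rfl⟩
    · have := h1.symm.cr_first_neg e1 e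
      exact ⟨this.le, fun h0 => absurd h0 this.ne⟩
  have e5 : 0 ≤ cr v b' u ∧ (cr v b' u = 0 → b' = u) := by
    by_cases e : b' = u
    · subst e; exact ⟨(cr_self_right _ _).ge, fun _ => rfl⟩
    · have := h2.cr_second_pos d2 e
      exact ⟨this.le, fun h0 => absurd h0 this.ne'⟩
  have sb := dt_self_pos (ne_left_of_cr_pos h1.cr_right)
  have sb' := dt_self_pos (ne_right_of_cr_pos h1.cr_right)
  have f1 := dt_frame v b' w u
  have f2 := cr_frame v b' w u
  have f3 := dt_frame v b w u
  have f4 := cr_frame v b w u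
  have k1 : 0 ≤ dt v b' u := by
    by_contra hh
    push Not at hh
    have := mul_nonpos_of_nonpos_of_nonneg e1 e5.1
    have := mul_pos_of_neg_of_neg e2 hh
    have := mul_pos sb' hc
    linarith
  have k2 : 0 ≤ dt v b w := by
    by_contra hh
    push Not at hh
    have := mul_neg_of_neg_of_pos hh e3
    have := mul_nonneg_of_nonpos_of_nonpos e4.1 d2
    have := mul_pos sb hc
    linarith
  have l1 := mul_nonpos_of_nonpos_of_nonneg e1 k1
  have l2 := mul_nonpos_of_nonpos_of_nonneg e2.le e5.1
  have l3 := mul_nonpos_of_nonneg_of_nonpos k2 d2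
  have l4 := mul_nonpos_of_nonpos_of_nonneg e4.1 e3.le
  constructor
  · by_contra hh
    push Not at hh
    have := mul_pos sb hh
    linarith
  · intro h0
    rw [h0, mul_zero] at f1 f3
    have z1 : cr v b' w * cr v b' u = 0 := by linarith
    have z2 : cr v b w * cr v b u = 0 := by linarith
    exact ⟨e4.2 ((mul_eq_zero.1 z2).resolve_right e3.ne'),
      e5.2 ((mul_eq_zero.1 z1).resolve_left e2.ne)⟩

open EuclideanGeometry in
theorem pi_div_two_le_of_path (h1 : Facing w a a' v b b') (d1 : dt w a v ≤ 0)
    (h2 : Facing v b b' u c c') (d2 : dt v b u ≤ 0) (w1 : 0 < dt w a o) (w2 : 0 < dt w a' o)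
    (o1 : 0 < dt v b o) (o2 : 0 < dt v b' o) :
    Real.pi / 2 ≤ ∠ w v o + ∠ o v u ∧
      (¬ (b = w ∧ b' = u) → Real.pi / 2 < ∠ w v o + ∠ o v u) := by
  have t1 : 0 < cr v w o := by
    rw [← cr_rotate]
    have : cr w o v = cr o v w := by unfold cr; ring
    rw [this]; exact h1.cr_center_pos d1 w1 w2
  have t2 : 0 < cr v o u := by
    have : cr v o u = cr o u v := by unfold cr; ring
    rw [this]; exact h2.cr_center_pos d2 o1 o2
  have A := angle_add_angle_cases t1 t2
  constructor
  · by_contra hh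
    push Not at hh
    obtain ⟨x, y⟩ := A.1 hh
    linarith [(dt_nonpos_of_path h1 d1 h2 d2 x).1]
  · intro hn
    by_contra hh
    push Not at hh
    obtain ⟨x, y⟩ := A.2 hh
    have B := dt_nonpos_of_path h1 d1 h2 d2 x
    exact hn (B.2 (le_antisymm B.1 y))

end Facing

open EuclideanGeometry in
theorem angle_sum_of_conflict {w v o : Plane} (h : w ≠ v) :
    ∠ o w v + ∠ w v o + ∠ v o w = Real.pi := by
  have := EuclideanGeometry.angle_add_angle_add_angle_eq_pi (p₁ := v) (p₂ := w) o h
  rw [EuclideanGeometry.angle_comm o w v, EuclideanGeometry.angle_comm w v o,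
    EuclideanGeometry.angle_comm v o w]
  linarith

/-- Conflicts do not form a directed triangle. -/
theorem no_conflict_triangle {w a a' v b b' u c c' o : Plane}
    (h1 : Facing w a a' v b b') (h2 : Facing v b b' u c c') (h3 : Facing u c c' w a a')
    (d1 : dt w a v ≤ 0) (d2 : dt v b u ≤ 0) (d3 : dt u c w ≤ 0)
    (ow : 0 < dt w a o ∧ 0 < dt w a' o) (ov : 0 < dt v b o ∧ 0 < dt v b' o)
    (ou : 0 < dt u c o ∧ 0 < dt u c' o) : False := by
  have s1 := h1.cr_center_pos d1 ow.1 ow.2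
  have s2 := h2.cr_center_pos d2 ov.1 ov.2
  have s3 := h3.cr_center_pos d3 ou.1 ou.2
  have S := two_pi_le_angle_sum_three s1 s3 s2
  have t1 := angle_sum_of_conflict (o := o) h1.ne
  have t2 := angle_sum_of_conflict (o := o) h2.ne
  have t3 := angle_sum_of_conflict (o := o) h3.ne
  have n1 := (Facing.pi_div_two_le_of_path h1 d1 h2 d2 ow.1 ow.2 ov.1 ov.2).1
  have n2 := (Facing.pi_div_two_le_of_path h2 d2 h3 d3 ov.1 ov.2 ou.1 ou.2).1
  have n3 := (Facing.pi_div_two_le_of_path h3 d3 h1 d1 ou.1 ou.2 ow.1 ow.2).1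
  -- The three triangles at `o` have angle sum 3π, of which at least 2π lies at `o`. At most π
  -- remains for three angles of at least π/2 each.
  linarith [Real.pi_pos]

/-- Conflicts do not form a directed quadrilateral. -/
theorem no_conflict_quadrilateral {w a a' v b b' u c c' t e e' o : Plane}
    (h1 : Facing w a a' v b b') (h2 : Facing v b b' u c c') (h3 : Facing u c c' t e e')
    (h4 : Facing t e e' w a a')
    (d1 : dt w a v ≤ 0) (d2 : dt v b u ≤ 0) (d3 : dt u c t ≤ 0) (d4 : dt t e w ≤ 0)
    (ow : 0 < dt w a o ∧ 0 < dt w a' o) (ov : 0 < dt v b o ∧ 0 < dt v b' o)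
    (ou : 0 < dt u c o ∧ 0 < dt u c' o) (ot : 0 < dt t e o ∧ 0 < dt t e' o)
    (hne : b' ≠ e) : False := by
  have s1 := h1.cr_center_pos d1 ow.1 ow.2
  have s2 := h2.cr_center_pos d2 ov.1 ov.2
  have s3 := h3.cr_center_pos d3 ou.1 ou.2
  have s4 := h4.cr_center_pos d4 ot.1 ot.2
  have S := two_pi_le_angle_sum_four s1 s4 s3 s2
  have t1 := angle_sum_of_conflict (o := o) h1.ne
  have t2 := angle_sum_of_conflict (o := o) h2.ne
  have t3 := angle_sum_of_conflict (o := o) h3.ne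
  have t4 := angle_sum_of_conflict (o := o) h4.ne
  have n1 := Facing.pi_div_two_le_of_path h1 d1 h2 d2 ow.1 ow.2 ov.1 ov.2
  have n2 := (Facing.pi_div_two_le_of_path h2 d2 h3 d3 ov.1 ov.2 ou.1 ou.2).1
  have n3 := Facing.pi_div_two_le_of_path h3 d3 h4 d4 ou.1 ou.2 ot.1 ot.2
  have n4 := (Facing.pi_div_two_le_of_path h4 d4 h1 d1 ot.1 ot.2 ow.1 ow.2).1
  -- At most 2π remains for the four angles at the witnesses, so each would equal π/2. Equality at
  -- `v` needs `b' = u`, equality at `t` needs `e = u`, contrary to `hne`.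
  by_cases hb : b = w ∧ b' = u
  · have : ¬ (e = u ∧ e' = w) := fun he => hne (hb.2.trans he.1.symm)
    linarith [Real.pi_pos, n1.1, n3.2 this]
  · linarith [Real.pi_pos, n1.2 hb, n3.1]

/-! ### Witnessed parts and the transitive case -/

/-- `w` is a witness against the pair `q i k`, `q i l` of the `i`-th part, with `q i l`
counterclockwise from `q i k`, and against no pair of points of different parts. -/
structure IsWitness (q : Fin 4 → Fin 3 → Plane) (i : Fin 4) (w : Plane) (k l : Fin 3) : Prop where
  dt_nonpos : dt w (q i k) (q i l) ≤ 0
  cr_pos : 0 < cr w (q i k) (q i l)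
  sees : ∀ j, j ≠ i → ∀ m, q j m ≠ w → 0 < dt w (q i k) (q j m) ∧ 0 < dt w (q i l) (q j m)

namespace IsWitness

variable {q : Fin 4 → Fin 3 → Plane} {i j : Fin 4} {w v u w' v' : Plane} {k l m n r s : Fin 3}

theorem facing (h : IsWitness q i w k l) (h' : IsWitness q j v m n) (hij : i ≠ j) :
    Facing w (q i k) (q i l) v (q j m) (q j n) :=
  ⟨h.dt_nonpos, h.cr_pos, h'.dt_nonpos, h'.cr_pos, h.sees j hij.symm m, h.sees j hij.symm n,
    h'.sees i hij k, h'.sees i hij l⟩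

/-- In a transitively ordered part, the pair of the first two points does not capture a point of
another part that is followed by two points. -/
theorem not_captured_of_transitive (h0 : IsWitness q i w k l) (h1 : IsWitness q i w' l m)
    (h2 : IsWitness q i u k m) (g0 : IsWitness q j v n r) (g1 : IsWitness q j v' r s)
    (hij : i ≠ j) : ¬ 0 < cr (q i k) (q i l) (q j n) := by
  intro hc
  -- The captures propagate in turn: `n r` captures `l`, `l m` captures `r`, `r s` captures `m`, `k
  -- m` captures `r`, `n r` captures `k`. Then `n r` captures both points of the pair `k l`.
  have e1 := (h0.facing g0 hij).captured_iff.2 hc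
  have e2 := (g0.facing h1 hij.symm).captured_iff.2 e1
  have e3 := (h1.facing g1 hij).captured_iff.2 e2
  have e4 := (h2.facing g1 hij).captured_iff.1 e3
  have e5 := (g0.facing h2 hij.symm).captured_iff.1 e4
  exact (h0.facing g0 hij).not_captured_both e5 e1

/-- A witness captures a point of each cyclically ordered part. -/
theorem exists_captured_of_cyclic (h : IsWitness q i w k l) (g0 : IsWitness q j u 0 1)
    (g1 : IsWitness q j v 1 2) (g2 : IsWitness q j v' 2 0) (hij : i ≠ j) :
    ∃ m, 0 < cr (q i k) (q i l) (q j m) := by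
  by_contra hn
  push Not at hn
  have hn' : ∀ m, ¬ 0 < cr (q i k) (q i l) (q j m) := fun m => not_lt.2 (hn m)
  have a0 := (g0.facing h hij.symm).cr_neg_of_not_captured (hn' 0) (hn' 1)
  have a1 := (g1.facing h hij.symm).cr_neg_of_not_captured (hn' 1) (hn' 2)
  have a2 := (g2.facing h hij.symm).cr_neg_of_not_captured (hn' 2) (hn' 0)
  exact not_cr_neg_cyclic a0.1 a1.1 a2.1 a0.2 (by rw [dt_comm]; exact a2.2)

end IsWitness

/-- Four parts whose points are transitively ordered by their witnesses do not exist. -/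
theorem not_all_transitive {q : Fin 4 → Fin 3 → Plane} {W : Fin 4 → Fin 3 → Plane}
    (h0 : ∀ i, IsWitness q i (W i 0) 0 1) (h1 : ∀ i, IsWitness q i (W i 1) 1 2)
    (h2 : ∀ i, IsWitness q i (W i 2) 0 2) : False := by
  have key : ∀ i j, i ≠ j → 0 < dt (W i 0) (q i 0) (W j 0) ∧ 0 < dt (W i 0) (q i 1) (W j 0) := by
    intro i j hij
    have F := (h0 i).facing (h0 j) hij
    have n1 := (h0 i).not_captured_of_transitive (h1 i) (h2 i) (h0 j) (h1 j) hij
    have n2 := (h0 j).not_captured_of_transitive (h1 j) (h2 j) (h0 i) (h1 i) hij.symm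
    constructor
    · by_contra hh
      exact n1 (F.captured_iff.1 (F.dt_first_iff.1 (not_lt.1 hh)))
    · by_contra hh
      exact n2 (F.dt_second_iff.1 (not_lt.1 hh))
  refine four_points_not_all_acute (fun i => W i 0) fun i j k hij hik _ => ?_
  exact dt_pos_of_cone (h0 i).dt_nonpos (h0 i).cr_pos (key i j hij).1 (key i j hij).2
    (key i k hik).1 (key i k hik).2

/-! ### A common point of all acute cones -/

/-- The convex hulls of any three of the four parts have a common point, by Helly's theorem. -/
theorem exists_common_center (q : Fin 4 → Fin 3 → Plane) :
    ∃ o, ∀ i, o ∈ convexHull ℝ {x | ∃ j, j ≠ i ∧ ∃ m, x = q j m} := by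
  have hfr : Module.finrank ℝ Plane = 2 := by simp
  have := Convex.helly_theorem' (𝕜 := ℝ) (s := (Finset.univ : Finset (Fin 4)))
    (F := fun i => convexHull ℝ {x | ∃ j, j ≠ i ∧ ∃ m, x = q j m})
    (fun i _ => convex_convexHull ℝ _) (by
      intro I _ hI
      rw [hfr] at hI
      have : ∃ j, j ∉ I := by
        by_contra hn
        push Not at hn
        have : I = Finset.univ := Finset.eq_univ_of_forall hn
        rw [this] at hI
        simp at hI
      obtain ⟨j, hj⟩ := this
      -- At most three hulls are involved; a point of the part `j` whose hull is not among them lies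
      -- in all of them.
      refine ⟨q j 0, Set.mem_iInter₂.2 fun i hi => subset_convexHull ℝ _ ⟨j, ?_, 0, rfl⟩⟩
      rintro rfl
      exact hj hi)
  obtain ⟨o, ho⟩ := this
  exact ⟨o, fun i => Set.mem_iInter₂.1 ho i (Finset.mem_univ i)⟩

/-- An open half-plane together with a point of its boundary line is convex. -/
theorem convex_insert_halfPlane (w : Plane) (x y : ℝ) :
    Convex ℝ {p : Plane | p = w ∨ 0 < x * (p 0 - w 0) + y * (p 1 - w 1)} := by
  intro p hp r hr s t hs ht hst
  have e : x * ((s • p + t • r) 0 - w 0) + y * ((s • p + t • r) 1 - w 1) =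
      s * (x * (p 0 - w 0) + y * (p 1 - w 1)) + t * (x * (r 0 - w 0) + y * (r 1 - w 1)) := by
    simp only [PiLp.add_apply, PiLp.smul_apply, smul_eq_mul]
    linear_combination (x * w 0 + y * w 1) * hst
  rcases hs.eq_or_lt with rfl | hs
  · have : t = 1 := by linarith
    subst this; simpa using hr
  rcases ht.eq_or_lt with rfl | ht
  · have : s = 1 := by linarith
    subst this; simpa using hp
  show _ ∨ _
  rw [e]
  rcases hp with rfl | hp
  · rcases hr with rfl | hr
    · left; rw [← add_smul, hst, one_smul]
    · right; simp only [sub_self, mul_zero, add_zero, zero_add]; positivity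
  · rcases hr with rfl | hr
    · right; simp only [sub_self, mul_zero, add_zero]; positivity
    · right; positivity

/-- Points of other parts may coincide with `w`, so the open half-planes bounding the acute cone
must be enlarged by `w` before the hull fits in. -/
theorem IsWitness.center_eq_or {q : Fin 4 → Fin 3 → Plane} {i : Fin 4} {w o : Plane} {k l : Fin 3}
    (h : IsWitness q i w k l) (ho : o ∈ convexHull ℝ {x | ∃ j, j ≠ i ∧ ∃ m, x = q j m}) :
    (o = w ∨ 0 < dt w (q i k) o) ∧ (o = w ∨ 0 < dt w (q i l) o) ∧
      (o = w ∨ 0 < cr w (q i k) o) := by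
  refine ⟨?_, ?_, ?_⟩
  · refine convexHull_min ?_ (convex_insert_halfPlane w (q i k 0 - w 0) (q i k 1 - w 1)) ho
    rintro x ⟨j, hj, m, rfl⟩
    by_cases e : q j m = w
    · exact Or.inl e
    · exact Or.inr (h.sees j hj m e).1
  · refine convexHull_min ?_ (convex_insert_halfPlane w (q i l 0 - w 0) (q i l 1 - w 1)) ho
    rintro x ⟨j, hj, m, rfl⟩
    by_cases e : q j m = w
    · exact Or.inl e
    · exact Or.inr (h.sees j hj m e).2
  · have : o = w ∨ 0 < -(q i k 1 - w 1) * (o 0 - w 0) + (q i k 0 - w 0) * (o 1 - w 1) := by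
      refine convexHull_min ?_ (convex_insert_halfPlane w _ _) ho
      rintro x ⟨j, hj, m, rfl⟩
      by_cases e : q j m = w
      · exact Or.inl e
      · right
        have s := h.sees j hj m e
        have := cr_left_pos_of_cone h.dt_nonpos h.cr_pos s.1 s.2
        unfold cr at this
        linarith
    rcases this with e | e
    · exact Or.inl e
    · right; unfold cr; linarith

theorem IsWitness.ne_center {q : Fin 4 → Fin 3 → Plane} {i : Fin 4} {w o : Plane} {k l : Fin 3}
    (h : IsWitness q i w k l) (ho : o ∈ convexHull ℝ {x | ∃ j, j ≠ i ∧ ∃ m, x = q j m}) :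
    o ≠ q i k := by
  rintro rfl
  rcases (h.center_eq_or ho).2.2 with e | e
  · exact ne_left_of_cr_pos h.cr_pos e
  · rw [cr_self_right] at e; exact lt_irrefl _ e

theorem IsWitness.center_pos {q : Fin 4 → Fin 3 → Plane} {i : Fin 4} {w o : Plane} {k l : Fin 3}
    (h : IsWitness q i w k l) (ho : o ∈ convexHull ℝ {x | ∃ j, j ≠ i ∧ ∃ m, x = q j m})
    (hv : ∀ j m, o ≠ q j m) : 0 < dt w (q i k) o ∧ 0 < dt w (q i l) o := by
  have hw : o ≠ w := by
    rintro rfl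
    have hd : ∀ x ∈ {x | ∃ j, j ≠ i ∧ ∃ m, x = q j m}, x ∈ {p : Plane | 0 < dt o (q i k) p} := by
      rintro x ⟨j, hj, m, rfl⟩
      exact (h.sees j hj m (hv j m).symm).1
    have hconv : Convex ℝ {p : Plane | 0 < dt o (q i k) p} := by
      intro p hp r hr s t hs ht hst
      have e : dt o (q i k) (s • p + t • r) = s * dt o (q i k) p + t * dt o (q i k) r := by
        simp only [dt, PiLp.add_apply, PiLp.smul_apply, smul_eq_mul]
        linear_combination ((q i k 0 - o 0) * o 0 + (q i k 1 - o 1) * o 1) * hst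
      show 0 < dt o (q i k) (s • p + t • r)
      rw [e]
      have hp : 0 < dt o (q i k) p := hp
      have hr : 0 < dt o (q i k) r := hr
      rcases hs.eq_or_lt with rfl | hs
      · have : t = 1 := by linarith
        subst this; simpa using hr
      · have := mul_pos hs hp
        have := mul_nonneg ht hr.le
        linarith
    have := convexHull_min hd hconv ho
    simp [dt_apex_right] at this
  have := h.center_eq_or ho
  exact ⟨this.1.resolve_left hw, this.2.1.resolve_left hw⟩

/-! ### The cyclic case -/

/-- Four parts whose points are cyclically ordered by their witnesses do not exist. -/
theorem not_all_cyclic {q : Fin 4 → Fin 3 → Plane} {W : Fin 4 → Fin 3 → Plane}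
    (hinj : ∀ i j k l, i ≠ j → q i k ≠ q j l)
    (h : ∀ i k, IsWitness q i (W i k) k (k + 1)) : False := by
  obtain ⟨o, ho⟩ := exists_common_center q
  have hv : ∀ j m, o ≠ q j m := fun j m => (h j m).ne_center (ho j)
  have hO : ∀ i k, 0 < dt (W i k) (q i k) o ∧ 0 < dt (W i k) (q i (k + 1)) o :=
    fun i k => (h i k).center_pos (ho i) hv
  have F : ∀ {i j} k l, i ≠ j →
      Facing (W i k) (q i k) (q i (k + 1)) (W j l) (q j l) (q j (l + 1)) :=
    fun k l hij => (h _ k).facing (h _ l) hij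
  -- the captured point of the `j`-th part
  have ex : ∀ i j k, ∃ m, i ≠ j → 0 < cr (q i k) (q i (k + 1)) (q j m) := by
    intro i j k
    by_cases hij : i = j
    · exact ⟨0, fun hn => absurd hij hn⟩
    · obtain ⟨m, hm⟩ := (h i k).exists_captured_of_cyclic (h j 0) (h j 1) (h j 2) hij
      exact ⟨m, fun _ => hm⟩
  choose g hg using ex
  have uniq : ∀ i j k m, i ≠ j → 0 < cr (q i k) (q i (k + 1)) (q j m) → m = g i j k := by
    intro i j k m hij hm
    have hg' := hg i j k hij
    have no : ∀ l, 0 < cr (q i k) (q i (k + 1)) (q j l) →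
        0 < cr (q i k) (q i (k + 1)) (q j (l + 1)) → False := fun l a b =>
      (F l k hij.symm).not_captured_both a b
    generalize g i j k = m' at hg'
    have c : ∀ m m' : Fin 3, m = m' ∨ m' = m + 1 ∨ m = m' + 1 := by decide
    rcases c m m' with c | c | c
    · exact c
    · exact (no m hm (by rw [← c]; exact hg')).elim
    · exact (no m' hg' (by rw [← c]; exact hm)).elim
  have gg : ∀ i j k, i ≠ j → g j i (g i j k) = k + 1 := by
    intro i j k hij
    exact (uniq j i _ _ hij.symm ((F k (g i j k) hij).captured_iff.2 (hg i j k hij))).symm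
  have gs : ∀ i j k, i ≠ j → g i j (k + 1) = g i j k + 1 := by
    intro i j k hij
    rw [← gg i j k hij, gg j i _ hij.symm]
  have gc : ∀ i j k, i ≠ j → g i j k = g i j 0 + k := by
    intro i j k hij
    have e1 := gs i j 0 hij
    have e2 := gs i j 1 hij
    fin_cases k
    · simp
    · simpa using e1
    · have : g i j 2 = g i j 0 + 1 + 1 := by
        rw [show (2 : Fin 3) = 1 + 1 from rfl, e2, ← e1]; rfl
      show g i j 2 = g i j 0 + 2
      rw [this, add_assoc]; rfl
  have csum : ∀ i j, i ≠ j → g j i 0 + g i j 0 = 1 := by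
    intro i j hij
    have := gg i j 0 hij
    rw [gc j i _ hij.symm] at this
    simpa using this
  have arrow : ∀ i j k l, i ≠ j → l = g i j 0 + k → dt (W i k) (q i k) (W j l) ≤ 0 := by
    intro i j k l hij e
    rw [← gc i j k hij] at e
    rw [(F k l hij).dt_first_iff, (F k l hij).captured_iff, e]
    exact hg i j k hij
  have tri : ∀ i j m, i ≠ j → j ≠ m → m ≠ i → g i j 0 + g j m 0 + g m i 0 ≠ 0 := by
    intro i j m h1 h2 h3 e
    refine no_conflict_triangle (F 0 (g i j 0) h1) (F (g i j 0) (g j m 0 + g i j 0) h2)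
      (F (g j m 0 + g i j 0) 0 h3) (arrow i j _ _ h1 (by simp)) (arrow j m _ _ h2 rfl)
      (arrow m i _ _ h3 ?_) (hO _ _) (hO _ _) (hO _ _)
    refine e.symm.trans ?_; abel
  have quad : ∀ i j m n, i ≠ j → j ≠ m → m ≠ n → n ≠ i → j ≠ n →
      g i j 0 + g j m 0 + g m n 0 + g n i 0 ≠ 0 := by
    intro i j m n h1 h2 h3 h4 h5 e
    refine no_conflict_quadrilateral (F 0 (g i j 0) h1) (F (g i j 0) (g j m 0 + g i j 0) h2)
      (F (g j m 0 + g i j 0) (g m n 0 + (g j m 0 + g i j 0)) h3)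
      (F (g m n 0 + (g j m 0 + g i j 0)) 0 h4)
      (arrow i j _ _ h1 (by simp)) (arrow j m _ _ h2 rfl) (arrow m n _ _ h3 rfl)
      (arrow n i _ _ h4 ?_) (hO _ _) (hO _ _) (hO _ _) (hO _ _) (hinj _ _ _ _ h5)
    refine e.symm.trans ?_; abel
  -- Reversing a 4-cycle of parts turns its sum `s` of shifts into `4 - s = 1 - s` mod 3. Excluding
  -- 0 in both directions forces `s = 2`, and the resulting three equations make the sum around the
  -- triangle `0 1 2` vanish.
  have fin : ∀ a b c d e f a' b' c' d' e' f' : Fin 3, a' = 1 - a → b' = 1 - b → c' = 1 - c →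
      d' = 1 - d → e' = 1 - e → f' = 1 - f →
      a + d + b' ≠ 0 → a + d + f + c' ≠ 0 → c + f' + d' + a' ≠ 0 →
      a + e + f' + b' ≠ 0 → b + f + e' + a' ≠ 0 → b + d' + e + c' ≠ 0 →
      c + e' + d + b' ≠ 0 → False := by
    intro a b c d e f a' b' c' d' e' f' ha hb hc hd he hf
    subst ha hb hc hd he hf
    revert a b c d e f
    decide
  have cs : ∀ i j, i ≠ j → g j i 0 = 1 - g i j 0 := fun i j hij => eq_sub_of_add_eq (csum i j hij)
  exact fin (g 0 1 0) (g 0 2 0) (g 0 3 0) (g 1 2 0) (g 1 3 0) (g 2 3 0) (g 1 0 0) (g 2 0 0)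
    (g 3 0 0) (g 2 1 0) (g 3 1 0) (g 3 2 0) (cs 0 1 (by decide)) (cs 0 2 (by decide))
    (cs 0 3 (by decide)) (cs 1 2 (by decide)) (cs 1 3 (by decide)) (cs 2 3 (by decide))
    (tri 0 1 2 (by decide) (by decide) (by decide))
    (quad 0 1 2 3 (by decide) (by decide) (by decide) (by decide) (by decide))
    (quad 0 3 2 1 (by decide) (by decide) (by decide) (by decide) (by decide))
    (quad 0 1 3 2 (by decide) (by decide) (by decide) (by decide) (by decide))
    (quad 0 2 3 1 (by decide) (by decide) (by decide) (by decide) (by decide))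
    (quad 0 2 1 3 (by decide) (by decide) (by decide) (by decide) (by decide))
    (quad 0 3 1 2 (by decide) (by decide) (by decide) (by decide) (by decide))

/-! ### From drawings to witnesses -/

theorem mem_diametralDisk_iff {a b w : Plane} : w ∈ diametralDisk a b ↔ dt w a b ≤ 0 := by
  have hm : ∀ i, (midpoint ℝ a b) i = (a i + b i) / 2 := by
    intro i
    simp [midpoint_eq_smul_add]; ring
  rw [diametralDisk, Metric.mem_closedBall, EuclideanSpace.dist_eq, EuclideanSpace.dist_eq,
    Fin.sum_univ_two, Fin.sum_univ_two, Real.dist_eq, Real.dist_eq, Real.dist_eq, Real.dist_eq,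
    sq_abs, sq_abs, sq_abs, sq_abs, hm, hm]
  have h4 : √((a 0 - b 0) ^ 2 + (a 1 - b 1) ^ 2) / 2 =
      √(((a 0 - b 0) ^ 2 + (a 1 - b 1) ^ 2) / 4) := by
    rw [Real.sqrt_div (by positivity), show (4 : ℝ) = 2 ^ 2 by norm_num,
      Real.sqrt_sq (by norm_num)]
  rw [h4, Real.sqrt_le_sqrt_iff (by positivity)]
  unfold dt
  constructor <;> intro h <;> linarith

/-- Three points that are pairwise ordered form a transitive or a cyclic triple. -/
theorem exists_transitive_or_cyclic {R : Fin 3 → Fin 3 → Prop} (h : ∀ k l, k ≠ l → R k l ∨ R l k) :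
    ∃ a : Fin 3 → Fin 3, R (a 0) (a 1) ∧ R (a 1) (a 2) ∧
      (R (a 0) (a 2) ∨ R (a 2) (a 0)) := by
  rcases h 0 1 (by decide) with h1 | h1 <;> rcases h 1 2 (by decide) with h2 | h2 <;>
    rcases h 0 2 (by decide) with h3 | h3
  · exact ⟨![0, 1, 2], h1, h2, Or.inl h3⟩
  · exact ⟨![0, 1, 2], h1, h2, Or.inr h3⟩
  · exact ⟨![0, 2, 1], h3, h2, Or.inl h1⟩
  · exact ⟨![2, 0, 1], h3, h1, Or.inl h2⟩
  · exact ⟨![1, 0, 2], h1, h3, Or.inl h2⟩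
  · exact ⟨![1, 2, 0], h2, h3, Or.inl h1⟩
  · exact ⟨![0, 2, 1], h3, h2, Or.inr h1⟩
  · exact ⟨![2, 1, 0], h2, h1, Or.inl h3⟩

theorem not_exists_witnesses {p : Fin 4 → Fin 3 → Plane}
    (hinj : ∀ i j k l, i ≠ j → p i k ≠ p j l)
    (h : ∀ i k l, k ≠ l → ∃ w, IsWitness p i w k l ∨ IsWitness p i w l k) : False := by
  have hR : ∀ i, ∃ a : Fin 3 → Fin 3, (∃ w, IsWitness p i w (a 0) (a 1)) ∧
      (∃ w, IsWitness p i w (a 1) (a 2)) ∧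
      ((∃ w, IsWitness p i w (a 0) (a 2)) ∨ ∃ w, IsWitness p i w (a 2) (a 0)) := fun i =>
    exists_transitive_or_cyclic (R := fun k l => ∃ w, IsWitness p i w k l) fun k l hkl =>
      exists_or.1 (h i k l hkl)
  choose a h0 h1 h2 using hR
  have relabel : ∀ {i w k l}, IsWitness p i w (a i k) (a i l) →
      IsWitness (fun i k => p i (a i k)) i w k l := fun hw =>
    ⟨hw.dt_nonpos, hw.cr_pos, fun j hj m => hw.sees j hj (a j m)⟩
  choose w0 h0 using h0
  choose w1 h1 using h1
  by_cases hT : ∀ i, ∃ w, IsWitness p i w (a i 0) (a i 2)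
  · choose w2 h2 using hT
    exact not_all_transitive (W := fun i => ![w0 i, w1 i, w2 i]) (fun i => relabel (h0 i))
      (fun i => relabel (h1 i)) (fun i => relabel (h2 i))
  · push Not at hT
    obtain ⟨j, hj⟩ := hT
    have cj := (h2 j).resolve_left fun ⟨w, hw⟩ => hj w hw
    obtain ⟨wj, hwj⟩ := cj
    have hY : ∀ i, ∃ w, IsWitness p i w (a i 2) (a i 0) := by
      intro i
      rcases h2 i with ⟨w, hw⟩ | hw
      · exfalso
        have hij : i ≠ j := by
          rintro rfl; exact hj w hw
        -- No mixture: the first pair of the transitive part `i` captures a point of the cyclic part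
        -- `j`, where every point is followed by two others.
        obtain ⟨m, hm⟩ := (relabel (h0 i)).exists_captured_of_cyclic (relabel (h0 j))
          (relabel (h1 j)) (relabel hwj) hij
        have no : ∀ {v v' n r s}, IsWitness (fun i k => p i (a i k)) j v n r →
            IsWitness (fun i k => p i (a i k)) j v' r s →
            ¬ 0 < cr (p i (a i 0)) (p i (a i 1)) (p j (a j n)) := fun g0 g1 =>
          (relabel (h0 i)).not_captured_of_transitive (relabel (h1 i)) (relabel hw) g0 g1 hij
        fin_cases m
        · exact no (relabel (h0 j)) (relabel (h1 j)) hm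
        · exact no (relabel (h1 j)) (relabel hwj) hm
        · exact no (relabel hwj) (relabel (h0 j)) hm
      · exact hw
    choose w2 h2 using hY
    refine not_all_cyclic (q := fun i k => p i (a i k)) (W := fun i => ![w0 i, w1 i, w2 i])
      (fun i j k l hij => hinj i j _ _ hij) fun i k => ?_
    fin_cases k
    · exact relabel (h0 i)
    · exact relabel (h1 i)
    · exact relabel (h2 i)

theorem witness_of_not_adj {P W : Set Plane} {p : Fin 4 → Fin 3 → P}
    (hinj : ∀ i k l, k ≠ l → p i k ≠ p i l)
    (hadj : ∀ i j k l, (witnessGabrielGraph P W).Adj (p i k) (p j l) ↔ i ≠ j) (i : Fin 4)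
    (k l : Fin 3) (hkl : k ≠ l) :
    ∃ w, IsWitness (fun i k => (p i k : Plane)) i w k l ∨
      IsWitness (fun i k => (p i k : Plane)) i w l k := by
  have hn : ¬ (witnessGabrielGraph P W).Adj (p i k) (p i l) := by simp [hadj]
  have hne : (W ∩ (diametralDisk (p i k : Plane) (p i l) \
      {(p i k : Plane), (p i l : Plane)})).Nonempty := by
    rw [Set.nonempty_iff_ne_empty]
    exact fun he => hn ⟨hinj i k l hkl, he⟩
  obtain ⟨w, hwW, hwD, hw⟩ := hne
  rw [Set.mem_insert_iff, Set.mem_singleton_iff, not_or] at hw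
  rw [mem_diametralDisk_iff] at hwD
  have hsee : ∀ m j n, j ≠ i → (p i m : Plane) ≠ w → (p j n : Plane) ≠ w →
      0 < dt w (p i m) (p j n) := by
    intro m j n hj h1 h2
    by_contra hh
    have ha := ((hadj i j m n).2 hj.symm).2
    have : w ∈ (∅ : Set Plane) := by
      rw [← ha]
      refine ⟨hwW, mem_diametralDisk_iff.2 (not_lt.1 hh), ?_⟩
      rw [Set.mem_insert_iff, Set.mem_singleton_iff, not_or]
      exact ⟨h1.symm, h2.symm⟩
    exact this
  have h1 : (p i k : Plane) ≠ w := fun e => hw.1 e.symm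
  have h2 : (p i l : Plane) ≠ w := fun e => hw.2 e.symm
  rcases lt_trichotomy (cr w (p i k) (p i l)) 0 with hc | hc | hc
  · refine ⟨w, Or.inr ⟨by rw [dt_comm]; exact hwD, ?_, fun j hj m hm =>
      ⟨hsee l j m hj h2 hm, hsee k j m hj h1 hm⟩⟩⟩
    rw [cr_swap]; exact neg_pos.2 hc
  · exfalso
    -- If `w` is collinear with the pair, its two points lie in opposite directions from `w`, so no
    -- point of another part makes acute angles with both.
    obtain ⟨j, hj⟩ : ∃ j, j ≠ i := exists_ne i
    obtain ⟨m, hm⟩ : ∃ m, (p j m : Plane) ≠ w := by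
      by_contra hh
      push Not at hh
      exact hinj j 0 1 (by decide) (Subtype.ext ((hh 0).trans (hh 1).symm))
    have e := dt_frame w (p i k) (p i l) (p j m)
    rw [hc, zero_mul, add_zero] at e
    have := mul_pos (dt_self_pos h1) (hsee l j m hj h2 hm)
    have := mul_nonpos_of_nonpos_of_nonneg hwD (hsee k j m hj h1 hm).le
    linarith
  · exact ⟨w, Or.inl ⟨hwD, hc, fun j hj m hm => ⟨hsee k j m hj h1 hm, hsee l j m hj h2 hm⟩⟩⟩

theorem not_hasWitnessGabrielDrawing_of_isIndContained {V : Type*} (G : SimpleGraph V)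
    (hG : (completeFourPartite 3 3 3 3).IsIndContained G) : ¬ HasWitnessGabrielDrawing G := by
  rintro ⟨P, W, -, ⟨φ⟩⟩
  obtain ⟨e⟩ := hG
  have hlen : ∀ i : Fin 4, 3 = (![3, 3, 3, 3] : Fin 4 → ℕ) i := by decide
  let p : Fin 4 → Fin 3 → P := fun i k => φ (e ⟨i, Fin.cast (hlen i) k⟩)
  have hadj : ∀ i j k l, (witnessGabrielGraph P W).Adj (p i k) (p j l) ↔ i ≠ j := by
    intro i j k l
    rw [φ.map_adj_iff, e.map_adj_iff]
    simp
  have hinj : ∀ i k l, k ≠ l → p i k ≠ p i l := by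
    intro i k l hkl he
    have := e.injective (φ.injective he)
    simp at this
    exact hkl this
  exact not_exists_witnesses (fun i j k l hij he => ((hadj i j k l).2 hij).ne (Subtype.ext he))
    (witness_of_not_adj hinj hadj)

theorem completeFourPartite_isIndContained {p q r s : ℕ} (hp : 3 ≤ p) (hq : 3 ≤ q) (hr : 3 ≤ r)
    (hs : 3 ≤ s) : (completeFourPartite 3 3 3 3).IsIndContained (completeFourPartite p q r s) := by
  have hlen : ∀ i : Fin 4, (![3, 3, 3, 3] : Fin 4 → ℕ) i ≤ (![p, q, r, s] : Fin 4 → ℕ) i := by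
    intro i
    fin_cases i <;> assumption
  refine ⟨⟨⟨fun x => ⟨x.1, Fin.castLE (hlen x.1) x.2⟩, ?_⟩, ?_⟩⟩
  · rintro ⟨i, k⟩ ⟨j, l⟩ h
    simp only [Sigma.mk.injEq] at h
    obtain ⟨rfl, h⟩ := h
    simpa using h
  · exact Iff.rfl

theorem mainTheorem1 :
    ¬ HasWitnessGabrielDrawing (completeFourPartite 3 3 3 3) ∧
    (∀ {V : Type*} (G : SimpleGraph V),
      (completeFourPartite 3 3 3 3).IsIndContained G → ¬ HasWitnessGabrielDrawing G) ∧
    (∀ p q r s : ℕ, 3 ≤ p → 3 ≤ q → 3 ≤ r → 3 ≤ s →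
      ¬ HasWitnessGabrielDrawing (completeFourPartite p q r s)) :=
  ⟨not_hasWitnessGabrielDrawing_of_isIndContained _ ⟨SimpleGraph.Embedding.refl⟩,
    fun G hG => not_hasWitnessGabrielDrawing_of_isIndContained G hG,
    fun _ _ _ _ hp hq hr hs => not_hasWitnessGabrielDrawing_of_isIndContained _
      (completeFourPartite_isIndContained hp hq hr hs)⟩
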